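/- Fix a real number $t>0$, and let $D\subset\mathbf{C}^2$ be an open set which, in some neighborhood of the origin, is given by $$\mathrm{Re}\,w+|z|^6+t|z|^2\,\mathrm{Re}(z^4)+|zw|^2<0,$$ where $(z,w)$ are the coordinates of $\mathbf{C}^2$. Then $0\in\partial D$, and the following hold. (i) If $t\le 9/5$, there is a neighborhood $U$ of the origin such that $D$ is (Levi) pseudoconvex at every point of $\partial D\cap U$ and strictly pseudoconvex at every point of $(\partial D\cap U)\setminus\{0\}$. (ii) If $t>1$, the origin is not a local peak point for $A^1(D)$. Here, for $p\in\partial D$ and a smooth defining function $r$ of $D$ near $p$ (that is, $r$ is real-valued and $C^\infty$ on a neighborhood $V$ of $p$, $D\cap V=\{r<0\}$ and $\nabla r\ne0$ on $V$), $D$ is pseudoconvex at $p$ if $\sum_{j,k}\frac{\partial^2 r}{\partial z_j\partial\bar z_k}(p)v_j\bar v_k\ge 0$ for all $v\in\mathbf{C}^2$ with $\sum_j\frac{\partial r}{\partial z_j}(p)v_j=0$, and strictly pseudoconvex at $p$ if the inequality is strict for all such $v\neq0$ (with $(z_1,z_2)=(z,w)$). For an open set $G$, $A^1(G)$ is the space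 of functions holomorphic on $G$ and of class $C^1$ on $\overline{G}$ (that is, they and their first derivatives extend continuously to $\overline G$). A point $p\in\partial D$ is a local peak point for $A^1(D)$ if for some open neighborhood $V$ of $p$ there is $f\in A^1(D\cap V)$ with $f(p)=1$ and $|f|<1$ on $\overline{D\cap V}\setminus\{p\}$. -/

import Mathlib

open Set Topology
open scoped ContDiff ComplexConjugate

namespace SeveralComplex

/-- The Wirtinger derivative `∂f/∂z_j` at `p`, namely `(∂f/∂x_j - i ∂f/∂y_j) / 2`.
Throughout, `ℂⁿ` is `Fin n → ℂ`; only its topology and differentiable structure are used. -/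
noncomputable def dz {n : ℕ} (j : Fin n) (f : (Fin n → ℂ) → ℂ) (p : Fin n → ℂ) : ℂ :=
  (fderiv ℝ f p (Pi.single j 1) - Complex.I * fderiv ℝ f p (Pi.single j Complex.I)) / 2

/-- The Wirtinger derivative `∂f/∂z̄_j` at `p`, namely `(∂f/∂x_j + i ∂f/∂y_j) / 2`. -/
noncomputable def dzbar {n : ℕ} (j : Fin n) (f : (Fin n → ℂ) → ℂ) (p : Fin n → ℂ) : ℂ :=
  (fderiv ℝ f p (Pi.single j 1) + Complex.I * fderiv ℝ f p (Pi.single j Complex.I)) / 2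

/-- `∂r_p(v) = ∑_j ∂r/∂z_j(p) v_j` for a real-valued function `r`. -/
noncomputable def del {n : ℕ} (r : (Fin n → ℂ) → ℝ) (p v : Fin n → ℂ) : ℂ :=
  ∑ j, dz j (fun q => (r q : ℂ)) p * v j

/-- The Levi form `L_p(r, v) = ∑_{j,k} ∂²r/∂z_j∂z̄_k(p) v_j v̄_k`. For `r` real-valued and of class
`C²` near `p` the sum is real, so taking the real part only changes the type. -/
noncomputable def leviForm {n : ℕ} (r : (Fin n → ℂ) → ℝ) (p v : Fin n → ℂ) : ℝ :=
  (∑ j, ∑ k, dz j (dzbar k (fun q => (r q : ℂ))) p * v j * conj (v k)).re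

/-- `r` is a smooth (that is, `C^∞`) defining function for `D` on the open set `V`. -/
structure IsDefiningFunctionOn {n : ℕ} (D V : Set (Fin n → ℂ)) (r : (Fin n → ℂ) → ℝ) : Prop where
  isOpen : IsOpen V
  smooth : ContDiffOn ℝ ∞ r V
  inter_eq : V ∩ D = {z ∈ V | r z < 0}
  fderiv_ne_zero : ∀ z ∈ V, fderiv ℝ r z ≠ 0

/-- `D` has smooth boundary near its boundary point `p` and is Levi pseudoconvex at `p`: the Levi
form at `p` of a smooth defining function is nonnegative on the complex tangent space at `p`. -/
def IsPseudoconvexAt {n : ℕ} (D : Set (Fin n → ℂ)) (p : Fin n → ℂ) : Prop :=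
  p ∈ frontier D ∧ ∃ V r, p ∈ V ∧ IsDefiningFunctionOn D V r ∧
    ∀ v, del r p v = 0 → 0 ≤ leviForm r p v

/-- `D` has smooth boundary near its boundary point `p` and is strictly pseudoconvex at `p`: the
Levi form at `p` of a smooth defining function is positive definite on the complex tangent space
at `p`. -/
def IsStrictlyPseudoconvexAt {n : ℕ} (D : Set (Fin n → ℂ)) (p : Fin n → ℂ) : Prop :=
  p ∈ frontier D ∧ ∃ V r, p ∈ V ∧ IsDefiningFunctionOn D V r ∧
    ∀ v, del r p v = 0 → v ≠ 0 → 0 < leviForm r p v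

/-- Membership in `A^k(D)`, for `D` open: `f` is holomorphic on `D` and of class `C^k` on the
closure of `D`, that is, `f` is continuous on the closure and its (real) derivatives of every order
at most `k` extend continuously from `D` to the closure. The values of `f` off the closure of `D`
are irrelevant. -/
structure MemA {n : ℕ} (k : ℕ∞) (D : Set (Fin n → ℂ)) (f : (Fin n → ℂ) → ℂ) : Prop where
  holomorphic : DifferentiableOn ℂ f D
  continuousOn : ContinuousOn f (closure D)
  exists_extension : ∀ j : ℕ, (j : ℕ∞) ≤ k →
    ∃ F, ContinuousOn F (closure D) ∧ EqOn F (iteratedFDeriv ℝ j f) D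

/-- The boundary point `p` of `D` is a peak point relative to `D` for `A^k(D)`. -/
def IsPeakPoint {n : ℕ} (k : ℕ∞) (D : Set (Fin n → ℂ)) (p : Fin n → ℂ) : Prop :=
  ∃ f, MemA k D f ∧ f p = 1 ∧ ∀ z ∈ closure D \ {p}, ‖f z‖ < 1

/-- The boundary point `p` of `D` is a local peak point for `A^k(D)`. -/
def IsLocalPeakPoint {n : ℕ} (k : ℕ∞) (D : Set (Fin n → ℂ)) (p : Fin n → ℂ) : Prop :=
  ∃ V, IsOpen V ∧ p ∈ V ∧ IsPeakPoint k (D ∩ V) p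

/-- `Re w + |z|⁶ + t |z|² Re (z⁴) + |z w|²`, in the coordinates `z = p 0` and `w = p 1`. -/
noncomputable def fornaessFunction (t : ℝ) (p : Fin 2 → ℂ) : ℝ :=
  (p 1).re + ‖p 0‖ ^ 6 + t * ‖p 0‖ ^ 2 * (p 0 ^ 4).re + ‖p 0 * p 1‖ ^ 2

end SeveralComplex

/-! Write r for the defining function. For (i), its Levi form is (9|z|⁴ + 5t Re z⁴)|v₀|² + |w v₀ + z
v₁|², nonnegative when t ≤ 9/5. If it vanishes on a nonzero tangent vector away from the origin,
then t = 9/5 and z⁴ = -|z|⁴, and tangency forces w = -(24/5)|z|⁶, which is incompatible with r = 0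
(`leviForm_fornaessFunction_pos`).

For (ii), let f be a peak function and h = 1 - f, so Re h > 0 on the domain. Since f is C¹ up to the
boundary, h has almost constant slope -B in w near the origin (`MemA.exists_slope`), and the Hopf
lemma gives Re B > 0 (`slope_re_pos`). Freeze w = -m with m comparable to S⁶, so that the disc |z| <
S lies in the domain. There h(0, -m) ≈ Bm, so positivity makes h of size S⁶ on smaller discs.
Averaging over z ↦ iz, which preserves r, leaves h(0, -m) + b z⁴ up to an error of order S⁶(|z|/S)⁸.
Moving from -m to any real w with (z, w) in the domain and using Re h > 0 there bounds Re (b z⁴)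
below by Re B · w, up to small errors (`exists_fourth_coeff`).

Where z⁴ < 0, the hypothesis t > 1 admits w equal to a positive multiple of |z|⁶; at |z| = ηS this
forces Re b below a negative multiple of η²S². Where z⁴ > 0, at |z| = η'S, it gives Re b ≥ -C η'²S²
up to errors. For η' much smaller than η these exclude each other (`exists_scales_incompatible`). -/

namespace SeveralComplex

/-! ### Wirtinger calculus on ℂ². -/

/-- The real-linear form `a₀ dz + a₁ dw + b₀ dz̄ + b₁ dw̄` on `ℂ²`. -/
noncomputable def wirtingerForm (a₀ a₁ b₀ b₁ : ℂ) : (Fin 2 → ℂ) →L[ℝ] ℂ :=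
  let c (j : Fin 2) : (Fin 2 → ℂ) →L[ℝ] ℂ := ContinuousLinearMap.proj j
  let cbar (j : Fin 2) : (Fin 2 → ℂ) →L[ℝ] ℂ := (Complex.conjCLE : ℂ →L[ℝ] ℂ).comp (c j)
  a₀ • c 0 + a₁ • c 1 + (b₀ • cbar 0 + b₁ • cbar 1)

theorem wirtingerForm_apply (a₀ a₁ b₀ b₁ : ℂ) (v : Fin 2 → ℂ) :
    wirtingerForm a₀ a₁ b₀ b₁ v = a₀ * v 0 + a₁ * v 1 + (b₀ * conj (v 0) + b₁ * conj (v 1)) := by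
  simp [wirtingerForm]

/-- `f` is real-differentiable at `p` with the given Wirtinger derivatives. -/
def HasWirtingerAt (f : (Fin 2 → ℂ) → ℂ) (a₀ a₁ b₀ b₁ : ℂ) (p : Fin 2 → ℂ) : Prop :=
  HasFDerivAt f (wirtingerForm a₀ a₁ b₀ b₁) p

namespace HasWirtingerAt

variable {f g : (Fin 2 → ℂ) → ℂ} {a₀ a₁ b₀ b₁ a₀' a₁' b₀' b₁' : ℂ} {p : Fin 2 → ℂ}

theorem congr_coeff (hf : HasWirtingerAt f a₀ a₁ b₀ b₁ p) (h₁ : a₀ = a₀') (h₂ : a₁ = a₁')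
    (h₃ : b₀ = b₀') (h₄ : b₁ = b₁') : HasWirtingerAt f a₀' a₁' b₀' b₁' p := by
  subst h₁ h₂ h₃ h₄; exact hf

theorem const (c : ℂ) : HasWirtingerAt (fun _ => c) 0 0 0 0 p := by
  refine (hasFDerivAt_const c p).congr_fderiv ?_
  ext v; simp [wirtingerForm_apply]

theorem coord_zero : HasWirtingerAt (fun q => q 0) 1 0 0 0 p := by
  refine (hasFDerivAt_apply (𝕜 := ℝ) 0 p).congr_fderiv ?_
  ext v; simp [wirtingerForm_apply]

theorem coord_one : HasWirtingerAt (fun q => q 1) 0 1 0 0 p := by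
  refine (hasFDerivAt_apply (𝕜 := ℝ) 1 p).congr_fderiv ?_
  ext v; simp [wirtingerForm_apply]

theorem conjugate (hf : HasWirtingerAt f a₀ a₁ b₀ b₁ p) :
    HasWirtingerAt (fun q => conj (f q)) (conj b₀) (conj b₁) (conj a₀) (conj a₁) p := by
  refine ((Complex.conjCLE : ℂ →L[ℝ] ℂ).hasFDerivAt.comp p hf).congr_fderiv ?_
  ext v; simp [wirtingerForm_apply]; ring

theorem add (hf : HasWirtingerAt f a₀ a₁ b₀ b₁ p) (hg : HasWirtingerAt g a₀' a₁' b₀' b₁' p) :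
    HasWirtingerAt (fun q => f q + g q) (a₀ + a₀') (a₁ + a₁') (b₀ + b₀') (b₁ + b₁') p := by
  refine (HasFDerivAt.add hf hg).congr_fderiv ?_
  ext v; simp [wirtingerForm_apply]; ring

theorem mul (hf : HasWirtingerAt f a₀ a₁ b₀ b₁ p) (hg : HasWirtingerAt g a₀' a₁' b₀' b₁' p) :
    HasWirtingerAt (fun q => f q * g q) (f p * a₀' + g p * a₀) (f p * a₁' + g p * a₁)
      (f p * b₀' + g p * b₀) (f p * b₁' + g p * b₁) p := by
  refine (HasFDerivAt.mul hf hg).congr_fderiv ?_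
  ext v; simp [wirtingerForm_apply]; ring

theorem pow (hf : HasWirtingerAt f a₀ a₁ b₀ b₁ p) (n : ℕ) :
    HasWirtingerAt (fun q => f q ^ n) (n * f p ^ (n - 1) * a₀) (n * f p ^ (n - 1) * a₁)
      (n * f p ^ (n - 1) * b₀) (n * f p ^ (n - 1) * b₁) p := by
  refine (HasFDerivAt.pow hf n).congr_fderiv ?_
  ext v; simp [wirtingerForm_apply]; ring

theorem dz_zero (hf : HasWirtingerAt f a₀ a₁ b₀ b₁ p) : dz 0 f p = a₀ := by
  rw [dz, HasFDerivAt.fderiv hf]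
  simp only [wirtingerForm_apply]
  simp
  linear_combination (-a₀ / 2 + b₀ / 2) * Complex.I_mul_I

theorem dz_one (hf : HasWirtingerAt f a₀ a₁ b₀ b₁ p) : dz 1 f p = a₁ := by
  rw [dz, HasFDerivAt.fderiv hf]
  simp only [wirtingerForm_apply]
  simp
  linear_combination (-a₁ / 2 + b₁ / 2) * Complex.I_mul_I

theorem dzbar_zero (hf : HasWirtingerAt f a₀ a₁ b₀ b₁ p) : dzbar 0 f p = b₀ := by
  rw [dzbar, HasFDerivAt.fderiv hf]
  simp only [wirtingerForm_apply]
  simp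
  linear_combination (a₀ / 2 - b₀ / 2) * Complex.I_mul_I

theorem dzbar_one (hf : HasWirtingerAt f a₀ a₁ b₀ b₁ p) : dzbar 1 f p = b₁ := by
  rw [dzbar, HasFDerivAt.fderiv hf]
  simp only [wirtingerForm_apply]
  simp
  linear_combination (a₁ / 2 - b₁ / 2) * Complex.I_mul_I

end HasWirtingerAt

/-! ### The defining function, its Levi form and pseudoconvexity. -/

theorem ofReal_fornaessFunction (t : ℝ) (p : Fin 2 → ℂ) :
    (fornaessFunction t p : ℂ) = 1 / 2 * (p 1 + conj (p 1)) + p 0 ^ 3 * conj (p 0) ^ 3 +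
      t / 2 * (p 0 ^ 5 * conj (p 0) + p 0 * conj (p 0) ^ 5) +
      p 0 * conj (p 0) * (p 1 * conj (p 1)) := by
  have h6 : (‖p 0‖ : ℂ) ^ 6 = (p 0 * conj (p 0)) ^ 3 := by rw [Complex.mul_conj']; ring
  have hre (z : ℂ) : (z.re : ℂ) = (z + conj z) / 2 := by
    rw [Complex.add_conj]; push_cast; ring
  rw [fornaessFunction, norm_mul, mul_pow]
  push_cast
  rw [h6, ← Complex.mul_conj', ← Complex.mul_conj', hre, hre, map_pow]
  ring

theorem hasWirtingerAt_fornaessFunction (t : ℝ) (p : Fin 2 → ℂ) :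
    HasWirtingerAt (fun q => (fornaessFunction t q : ℂ))
      (3 * p 0 ^ 2 * conj (p 0) ^ 3 + t / 2 * (5 * p 0 ^ 4 * conj (p 0) + conj (p 0) ^ 5) +
        conj (p 0) * (p 1 * conj (p 1)))
      (1 / 2 + p 0 * conj (p 0) * conj (p 1))
      (3 * p 0 ^ 3 * conj (p 0) ^ 2 + t / 2 * (p 0 ^ 5 + 5 * p 0 * conj (p 0) ^ 4) +
        p 0 * (p 1 * conj (p 1)))
      (1 / 2 + p 0 * conj (p 0) * p 1) p := by
  simp only [ofReal_fornaessFunction]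
  have z : HasWirtingerAt (fun q => q 0) 1 0 0 0 p := .coord_zero
  have w : HasWirtingerAt (fun q => q 1) 0 1 0 0 p := .coord_one
  have c (a : ℂ) : HasWirtingerAt (fun _ => a) 0 0 0 0 p := .const a
  refine HasWirtingerAt.congr_coeff
    (((((c (1 / 2)).mul (w.add w.conjugate)).add ((z.pow 3).mul (z.conjugate.pow 3))).add
      ((c (t / 2)).mul (((z.pow 5).mul z.conjugate).add (z.mul (z.conjugate.pow 5))))).add
      ((z.mul z.conjugate).mul (w.mul w.conjugate))) ?_ ?_ ?_ ?_ <;>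
  · simp only [map_zero, map_one, Nat.cast_ofNat]
    ring

/-- The grouping of factors is the one produced by the rules of `HasWirtingerAt`, so that they can
differentiate it a second time. -/
theorem dzbar_zero_fornaessFunction (t : ℝ) :
    dzbar 0 (fun q => (fornaessFunction t q : ℂ)) = fun p : Fin 2 → ℂ =>
      3 * (p 0 ^ 3 * conj (p 0) ^ 2) + t / 2 * (p 0 ^ 5 + 5 * (p 0 * conj (p 0) ^ 4)) +
        p 0 * (p 1 * conj (p 1)) := by
  ext p
  rw [(hasWirtingerAt_fornaessFunction t p).dzbar_zero]
  ring

theorem dzbar_one_fornaessFunction (t : ℝ) :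
    dzbar 1 (fun q => (fornaessFunction t q : ℂ)) =
      fun p : Fin 2 → ℂ => 1 / 2 + p 0 * conj (p 0) * p 1 := by
  ext p
  rw [(hasWirtingerAt_fornaessFunction t p).dzbar_one]

/-- The Levi form of `fornaessFunction t`. -/
theorem leviForm_fornaessFunction (t : ℝ) (p v : Fin 2 → ℂ) :
    leviForm (fornaessFunction t) p v =
      (9 * ‖p 0‖ ^ 4 + 5 * t * (p 0 ^ 4).re) * ‖v 0‖ ^ 2 + ‖p 1 * v 0 + p 0 * v 1‖ ^ 2 := by
  have z : HasWirtingerAt (fun q => q 0) 1 0 0 0 p := .coord_zero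
  have w : HasWirtingerAt (fun q => q 1) 0 1 0 0 p := .coord_one
  have c (a : ℂ) : HasWirtingerAt (fun _ => a) 0 0 0 0 p := .const a
  have h₀ := (((c 3).mul ((z.pow 3).mul (z.conjugate.pow 2))).add
    ((c (t / 2)).mul ((z.pow 5).add ((c 5).mul (z.mul (z.conjugate.pow 4)))))).add
      (z.mul (w.mul w.conjugate))
  have h₁ := (c (1 / 2)).add ((z.mul z.conjugate).mul w)
  have hre : ((p 0 ^ 4).re : ℂ) = (p 0 ^ 4 + conj (p 0) ^ 4) / 2 := by
    rw [← map_pow, Complex.add_conj]; push_cast; ring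
  have h4 : (‖p 0‖ : ℂ) ^ 4 = (p 0 * conj (p 0)) ^ 2 := by rw [Complex.mul_conj']; ring
  rw [leviForm]
  simp only [Fin.sum_univ_two, dzbar_zero_fornaessFunction, dzbar_one_fornaessFunction,
    h₀.dz_zero, h₀.dz_one, h₁.dz_zero, h₁.dz_one]
  rw [← Complex.ofReal_re ((9 * ‖p 0‖ ^ 4 + _) * _ + _)]
  congr 1
  push_cast
  rw [hre, h4, ← Complex.mul_conj', ← Complex.mul_conj']
  simp only [map_zero, map_add, map_mul]
  ring

theorem contDiff_fornaessFunction (t : ℝ) : ContDiff ℝ ∞ (fornaessFunction t) := by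
  have e : fornaessFunction t = fun p => Complex.reCLM
      (1 / 2 * (p 1 + Complex.conjCLE (p 1)) + p 0 ^ 3 * Complex.conjCLE (p 0) ^ 3 +
      t / 2 * (p 0 ^ 5 * Complex.conjCLE (p 0) + p 0 * Complex.conjCLE (p 0) ^ 5) +
      p 0 * Complex.conjCLE (p 0) * (p 1 * Complex.conjCLE (p 1))) := by
    ext p
    have := congrArg Complex.re (ofReal_fornaessFunction t p)
    simpa using this
  rw [e]
  fun_prop

/-- The derivative in w is 1/2 + |z|² w̄, and |z|²|w| < 1/8 since the norm is the sup norm. -/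
theorem fderiv_fornaessFunction_ne_zero {t : ℝ} {p : Fin 2 → ℂ} (hp : ‖p‖ < 1 / 2) :
    fderiv ℝ (fornaessFunction t) p ≠ 0 := by
  intro h0
  have hd : HasFDerivAt (fornaessFunction t) (0 : (Fin 2 → ℂ) →L[ℝ] ℝ) p := by
    rw [← h0]
    exact ((contDiff_fornaessFunction t).differentiable (by simp) p).hasFDerivAt
  have h1 : HasFDerivAt (fun q => (fornaessFunction t q : ℂ))
      (0 : (Fin 2 → ℂ) →L[ℝ] ℂ) p := by
    refine (Complex.ofRealCLM.hasFDerivAt.comp p hd).congr_fderiv ?_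
    simp
  have h2 := (hasWirtingerAt_fornaessFunction t p).dz_one
  rw [dz, h1.fderiv] at h2
  simp at h2
  have h3 : ‖p 0 * conj (p 0) * conj (p 1)‖ = 1 / 2 := by
    rw [show p 0 * conj (p 0) * conj (p 1) = -(1 / 2) by linear_combination -h2]
    simp
  rw [norm_mul, norm_mul, RCLike.norm_conj, RCLike.norm_conj] at h3
  have ha := (norm_le_pi_norm p 0).trans_lt hp
  have hb := (norm_le_pi_norm p 1).trans_lt hp
  have hc : ‖p 0‖ * ‖p 0‖ ≤ 1 / 4 := by nlinarith [norm_nonneg (p 0)]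
  nlinarith [norm_nonneg (p 0), norm_nonneg (p 1)]

theorem leviForm_fornaessFunction_nonneg {t : ℝ} (ht : 0 < t) (ht' : t ≤ 9 / 5)
    (p v : Fin 2 → ℂ) : 0 ≤ leviForm (fornaessFunction t) p v := by
  rw [leviForm_fornaessFunction]
  have h := (abs_le.mp ((Complex.abs_re_le_norm (p 0 ^ 4)).trans_eq (norm_pow _ _))).1
  have h' : 0 ≤ 9 * ‖p 0‖ ^ 4 + 5 * t * (p 0 ^ 4).re := by
    nlinarith [pow_nonneg (norm_nonneg (p 0)) 4]
  positivity

theorem leviForm_fornaessFunction_pos {t : ℝ} (ht : 0 < t) (ht' : t ≤ 9 / 5)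
    {p v : Fin 2 → ℂ} (hp : ‖p‖ < 1 / 2) (hp0 : p ≠ 0) (hr : fornaessFunction t p = 0)
    (hv : v ≠ 0) (hdel : del (fornaessFunction t) p v = 0) :
    0 < leviForm (fornaessFunction t) p v := by
  refine (leviForm_fornaessFunction_nonneg ht ht' p v).lt_of_ne' fun h0 => ?_
  rw [leviForm_fornaessFunction] at h0
  have hre := (abs_le.mp ((Complex.abs_re_le_norm (p 0 ^ 4)).trans_eq (norm_pow _ _))).1
  have hn4 := pow_nonneg (norm_nonneg (p 0)) 4
  have hA : 0 ≤ 9 * ‖p 0‖ ^ 4 + 5 * t * (p 0 ^ 4).re := by nlinarith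
  have hz2 := (norm_le_pi_norm p 0).trans_lt hp
  have hw2 := (norm_le_pi_norm p 1).trans_lt hp
  rw [add_eq_zero_iff_of_nonneg (by positivity) (by positivity)] at h0
  obtain ⟨hA0, hB0⟩ := h0
  have hB : p 1 * v 0 + p 0 * v 1 = 0 := by simpa using hB0
  simp only [del, Fin.sum_univ_two, (hasWirtingerAt_fornaessFunction t p).dz_zero,
    (hasWirtingerAt_fornaessFunction t p).dz_one] at hdel
  have hne : (1 / 2 + p 0 * conj (p 0) * conj (p 1)) ≠ 0 := by
    intro h
    have h3 : ‖p 0 * conj (p 0) * conj (p 1)‖ = 1 / 2 := by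
      rw [show p 0 * conj (p 0) * conj (p 1) = -(1 / 2) by linear_combination h]
      simp
    rw [norm_mul, norm_mul, RCLike.norm_conj, RCLike.norm_conj] at h3
    have hc : ‖p 0‖ * ‖p 0‖ ≤ 1 / 4 := by nlinarith [norm_nonneg (p 0)]
    nlinarith [norm_nonneg (p 0), norm_nonneg (p 1)]
  have hv0 : v 0 ≠ 0 := by
    intro h
    rw [h, mul_zero, zero_add, mul_eq_zero] at hdel
    apply hv
    ext j
    fin_cases j
    · simpa using h
    · simpa using hdel.resolve_left hne
  have hz : p 0 ≠ 0 := by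
    intro h
    rw [h, zero_mul, add_zero, mul_eq_zero] at hB
    apply hp0
    ext j
    fin_cases j
    · simpa using h
    · simpa using hB.resolve_right hv0
  have hzpos : 0 < ‖p 0‖ := norm_pos_iff.mpr hz
  have hA1 : 9 * ‖p 0‖ ^ 4 + 5 * t * (p 0 ^ 4).re = 0 := by
    rcases mul_eq_zero.mp hA0 with h | h
    · exact h
    · exact absurd (by simpa using h) hv0
  have hn4' : 0 < ‖p 0‖ ^ 4 := by positivity
  have ht2 : t = 9 / 5 := by
    refine le_antisymm ht' ?_
    nlinarith
  have hre2 : (p 0 ^ 4).re = -‖p 0‖ ^ 4 := by rw [ht2] at hA1; linarith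
  have him : (p 0 ^ 4).im = 0 := by
    have := Complex.sq_norm (p 0 ^ 4)
    rw [Complex.normSq_apply, hre2, norm_pow] at this
    have h0 : (p 0 ^ 4).im * (p 0 ^ 4).im = 0 := by linarith
    simpa using h0
  have hz4 : p 0 ^ 4 = -(p 0 ^ 2 * conj (p 0) ^ 2) := by
    rw [← mul_pow, Complex.mul_conj']
    apply Complex.ext
    · rw [hre2, ← Complex.ofReal_pow, ← Complex.ofReal_pow, ← Complex.ofReal_neg,
        Complex.ofReal_re]; ring
    · rw [him, ← Complex.ofReal_pow, ← Complex.ofReal_pow, ← Complex.ofReal_neg,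
        Complex.ofReal_im]
  have hz4' : conj (p 0) ^ 4 = -(p 0 ^ 2 * conj (p 0) ^ 2) := by
    have := congrArg conj hz4
    simp only [map_neg, map_mul, map_pow, Complex.conj_conj] at this
    rw [this]; ring
  have hw : p 1 = ((-(24 / 5) * ‖p 0‖ ^ 6 : ℝ) : ℂ) := by
    have h6 : (‖p 0‖ : ℂ) ^ 6 = (p 0 * conj (p 0)) ^ 3 := by rw [Complex.mul_conj']; ring
    have ht3 : (t : ℂ) = 9 / 5 := by rw [ht2]; push_cast; ring
    -- Eliminate v₁ between tangency and w v₀ + z v₁ = 0: the terms |zw|² cancel, and z⁴ = -|z|⁴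
    -- leaves 6t - 6 = 24/5 as the coefficient of |z|⁶.
    have key : v 0 * (p 1 + 24 / 5 * (p 0 * conj (p 0)) ^ 3) = 0 := by
      rw [ht3] at hdel
      linear_combination -2 * p 0 * hdel + 2 * (1 / 2 + p 0 * conj (p 0) * conj (p 1)) * hB +
        9 * v 0 * p 0 * conj (p 0) * hz4 + 9 / 5 * v 0 * p 0 * conj (p 0) * hz4'
    have := (mul_eq_zero.mp key).resolve_left hv0
    push_cast
    rw [h6]
    linear_combination this
  rw [fornaessFunction, hre2, norm_mul, hw, Complex.ofReal_re, Complex.norm_real, ht2,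
    Real.norm_eq_abs, mul_pow, sq_abs] at hr
  have h8 : ‖p 0‖ ^ 8 < 1 / 100 := by
    calc ‖p 0‖ ^ 8 < (1 / 2) ^ 8 := by gcongr
      _ < 1 / 100 := by norm_num
  -- This is r = 0 after substitution: -24/5 + 1 - 9/5 = -28/5, and |zw|² contributes (24/5)²|z|¹⁴.
  have : ‖p 0‖ ^ 6 * (-(28 / 5) + 576 / 25 * ‖p 0‖ ^ 8) = 0 := by linear_combination hr
  rcases mul_eq_zero.mp this with h | h
  · exact absurd h (by positivity)
  · linarith

/-! ### Holomorphic functions with positive real part, and rotation averages. -/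

open Metric in
/-- A quantitative Harnack-type lower bound for holomorphic functions with positive real part. -/
theorem le_re_of_re_pos {h : ℂ → ℂ} {c z : ℂ} {R : ℝ} (hd : DifferentiableOn ℂ h (ball c R))
    (hpos : ∀ w ∈ ball c R, 0 < (h w).re) (hz : z ∈ ball c R) :
    (1 - (dist z c / R) ^ 2) * (h c).re / 4 ≤ (h z).re := by
  have hR : 0 < R := nonempty_ball.mp ⟨z, hz⟩
  have hc := hpos c (mem_ball_self hR)
  have hsq (w : ℂ) : ‖h w + conj (h c)‖ ^ 2 - ‖h w - h c‖ ^ 2 = 4 * (h w).re * (h c).re := by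
    simp only [Complex.sq_norm, Complex.normSq_apply]
    simp
    ring
  have hne : ∀ w ∈ ball c R, h w + conj (h c) ≠ 0 := by
    intro w hw h0
    have := congrArg Complex.re h0
    simp at this
    linarith [hpos w hw]
  -- Schwarz lemma for the composition of h with the Cayley transform of the right half-plane
  -- sending h c to 0.
  have hs := Complex.dist_le_div_mul_dist_of_mapsTo_ball (R₂ := 1)
    (f := fun w => (h w - h c) / (h w + conj (h c))) (c := c)
    ((hd.sub_const _).div (hd.add_const _) hne) (fun w hw => ?_) hz
  · simp only [sub_self, zero_div, dist_zero_right, norm_div] at hs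
    rw [div_le_iff₀ (norm_pos_iff.mpr (hne z hz))] at hs
    have hρ : 1 / R * dist z c = dist z c / R := by ring
    rw [hρ] at hs
    have hρ1 : dist z c / R < 1 := (div_lt_one hR).mpr hz
    have hρ0 : 0 ≤ dist z c / R := by positivity
    set ρ := dist z c / R
    have h1 : ‖h z - h c‖ ^ 2 ≤ ρ ^ 2 * ‖h z + conj (h c)‖ ^ 2 := by
      rw [← mul_pow]; gcongr
    have h2 : (h c).re ≤ ‖h z + conj (h c)‖ := by
      refine le_trans ?_ (Complex.re_le_norm _)
      simpa using (hpos z hz).le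
    have h3 : (h c).re ^ 2 ≤ ‖h z + conj (h c)‖ ^ 2 := by gcongr
    have h4 := hsq z
    have h5 : (1 - ρ ^ 2) * (h c).re ^ 2 ≤ 4 * (h z).re * (h c).re := by
      have : 0 ≤ 1 - ρ ^ 2 := by nlinarith
      nlinarith
    have h6 : ((1 - ρ ^ 2) * (h c).re) * (h c).re ≤ (4 * (h z).re) * (h c).re := by
      linarith [h5]
    linarith [le_of_mul_le_mul_right h6 hc]
  · have h1 := hsq w
    have h2 : 0 < 4 * (h w).re * (h c).re := by have := hpos w hw; positivity
    simp only [sub_self, zero_div, mem_closedBall, dist_zero_right, norm_div]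
    refine div_le_one_of_le₀ ?_ (norm_nonneg _)
    exact (sq_le_sq₀ (norm_nonneg _) (norm_nonneg _)).mp (by linarith)

/-- A holomorphic function with positive real part is controlled by its value at the centre. -/
theorem norm_le_of_re_pos {h : ℂ → ℂ} {z : ℂ} {S : ℝ}
    (hd : DifferentiableOn ℂ h (Metric.ball 0 S)) (hpos : ∀ w ∈ Metric.ball 0 S, 0 < (h w).re)
    (hS : 0 < S) (hz : ‖z‖ ≤ S / 2) : ‖h z‖ ≤ 3 * ‖h 0‖ := by
  have hz' : z ∈ Metric.ball (0 : ℂ) S := by rw [mem_ball_zero_iff]; linarith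
  have hM := hpos 0 (Metric.mem_ball_self hS)
  -- h 0 - h vanishes at 0 and has real part at most Re (h 0).
  have := Complex.borelCaratheodory_zero (f := fun w => h 0 - h w) hM (hd.const_sub _)
    (fun w hw => by simpa using (hpos w hw).le) hS hz' (sub_self _)
  have h2 : 2 * (h 0).re * ‖z‖ / (S - ‖z‖) ≤ 2 * ‖h 0‖ := by
    rw [div_le_iff₀ (by linarith)]
    have := Complex.re_le_norm (h 0)
    have h3 : (h 0).re * ‖z‖ ≤ ‖h 0‖ * ‖z‖ := by gcongr
    nlinarith [norm_nonneg (h 0)]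
  have h3 : ‖h z‖ ≤ ‖h 0‖ + ‖h 0 - h z‖ := by
    simpa using norm_sub_le (h 0) (h 0 - h z)
  linarith

open Metric in
/-- The average of a holomorphic function over a fourfold rotation orbit agrees with its Taylor
polynomial `h 0 + b z⁴` up to order eight. -/
theorem exists_average_rotation_sub_le {h : ℂ → ℂ} {R A : ℝ} (hR : 0 < R)
    (hd : DifferentiableOn ℂ h (closedBall 0 R)) (hA : ∀ z ∈ sphere (0 : ℂ) R, ‖h z‖ ≤ A) :
    ∃ b : ℂ, ∀ z : ℂ, ‖z‖ ≤ R / 2 →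
      ‖(h z + h (Complex.I * z) + h (-z) + h (-(Complex.I * z))) / 4 - h 0 - b * z ^ 4‖ ≤
        2 * A * (‖z‖ / R) ^ 8 := by
  have hA0 : 0 ≤ A := (norm_nonneg _).trans (hA (R : ℂ) (by simp [abs_of_pos hR]))
  have cauchy : ∀ z ∈ ball (0 : ℂ) R,
      (∮ ζ in C(0, R), (ζ - z)⁻¹ * h ζ) = 2 * Real.pi * Complex.I * h z := fun z hz => by
    simpa using hd.circleIntegral_sub_inv_smul hz
  have hs : ∀ ζ ∈ sphere (0 : ℂ) R, ζ ≠ 0 := fun ζ hζ h0 => by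
    simp [h0, hR.ne] at hζ
  have hcont := hd.continuousOn.mono (sphere_subset_closedBall (x := (0 : ℂ)) (ε := R))
  have int {z : ℂ} (hz : z ∈ ball (0 : ℂ) R) : CircleIntegrable (fun ζ => (ζ - z)⁻¹ * h ζ) 0 R := by
    refine ContinuousOn.circleIntegrable hR.le (ContinuousOn.mul ?_ hcont)
    refine ContinuousOn.inv₀ (by fun_prop) fun ζ hζ h0 => ?_
    rw [sub_eq_zero.mp h0] at hζ
    simp at hz hζ
    linarith
  have int5 : CircleIntegrable (fun ζ => (ζ ^ 5)⁻¹ * h ζ) 0 R := by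
    refine ContinuousOn.circleIntegrable hR.le (ContinuousOn.mul ?_ hcont)
    exact ContinuousOn.inv₀ (by fun_prop) fun ζ hζ => pow_ne_zero _ (hs ζ hζ)
  have hpi : (2 * Real.pi * Complex.I : ℂ) ≠ 0 := by simp [Real.pi_ne_zero]
  refine ⟨(2 * Real.pi * Complex.I)⁻¹ * ∮ ζ in C(0, R), (ζ ^ 5)⁻¹ * h ζ, fun z hz => ?_⟩
  have m0 : (0 : ℂ) ∈ ball (0 : ℂ) R := mem_ball_self hR
  have m1 : z ∈ ball (0 : ℂ) R := by rw [mem_ball_zero_iff]; linarith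
  have m2 : Complex.I * z ∈ ball (0 : ℂ) R := by simpa using m1
  have m3 : -z ∈ ball (0 : ℂ) R := by simpa using m1
  have m4 : -(Complex.I * z) ∈ ball (0 : ℂ) R := by simpa using m1
  -- The four Cauchy kernels average to ζ³/(ζ⁴ - z⁴); subtracting 1/ζ and z⁴/ζ⁵, the first two terms
  -- of its geometric series, leaves z⁸/(ζ⁵(ζ⁴ - z⁴)).
  have key : (h z + h (Complex.I * z) + h (-z) + h (-(Complex.I * z))) / 4 - h 0 -
      (2 * Real.pi * Complex.I)⁻¹ * (∮ ζ in C(0, R), (ζ ^ 5)⁻¹ * h ζ) * z ^ 4 =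
      (2 * Real.pi * Complex.I : ℂ)⁻¹ •
        ∮ ζ in C(0, R), z ^ 8 * (ζ ^ 5 * (ζ ^ 4 - z ^ 4))⁻¹ * h ζ := by
    have e : (∮ ζ in C(0, R), z ^ 8 * (ζ ^ 5 * (ζ ^ 4 - z ^ 4))⁻¹ * h ζ) =
        ∮ ζ in C(0, R), (1 / 4 * ((ζ - z)⁻¹ * h ζ + (ζ - Complex.I * z)⁻¹ * h ζ +
          (ζ - -z)⁻¹ * h ζ + (ζ - -(Complex.I * z))⁻¹ * h ζ) - (ζ - 0)⁻¹ * h ζ -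
          z ^ 4 * ((ζ ^ 5)⁻¹ * h ζ)) := by
      refine circleIntegral.integral_congr hR.le fun ζ hζ => ?_
      have n (x : ℂ) (hx : x ∈ ball (0 : ℂ) R) : ζ - x ≠ 0 := fun h0 => by
        rw [sub_eq_zero.mp h0] at hζ
        simp at hx hζ
        linarith
      have n0 := hs ζ hζ
      have n1 := n _ m1
      have n2 := n _ m2
      have n3 := n _ m3
      have n4 := n _ m4
      have hfac : ζ ^ 4 - z ^ 4 =
          (ζ - z) * (ζ - Complex.I * z) * (ζ - -z) * (ζ - -(Complex.I * z)) := by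
        linear_combination (ζ ^ 2 - z ^ 2) * z ^ 2 * Complex.I_sq
      have hsum : (ζ - z)⁻¹ + (ζ - Complex.I * z)⁻¹ + (ζ - -z)⁻¹ + (ζ - -(Complex.I * z))⁻¹ =
          4 * ζ ^ 3 * (ζ ^ 4 - z ^ 4)⁻¹ := by
        have inv_sum {a b c d : ℂ} (ha : a ≠ 0) (hb : b ≠ 0) (hc : c ≠ 0) (hd : d ≠ 0) :
            a⁻¹ + b⁻¹ + c⁻¹ + d⁻¹ =
              (b * c * d + a * c * d + a * b * d + a * b * c) * (a * b * c * d)⁻¹ := by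
          field_simp
        rw [inv_sum n1 n2 n3 n4, hfac]
        congr 1
        linear_combination (-2 * ζ * z ^ 2) * Complex.I_sq
      have n5 : ζ ^ 4 - z ^ 4 ≠ 0 := by
        rw [hfac]
        exact mul_ne_zero (mul_ne_zero (mul_ne_zero n1 n2) n3) n4
      have : 1 / 4 * ((ζ - z)⁻¹ * h ζ + (ζ - Complex.I * z)⁻¹ * h ζ +
          (ζ - -z)⁻¹ * h ζ + (ζ - -(Complex.I * z))⁻¹ * h ζ) =
          ζ ^ 3 * (ζ ^ 4 - z ^ 4)⁻¹ * h ζ := by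
        linear_combination 1 / 4 * h ζ * hsum
      rw [this, sub_zero]
      field_simp
      ring
    have i12 := (int m1).add (int m2)
    have i123 := i12.add (int m3)
    have i1234 := (i123.add (int m4)).const_smul (a := (1 / 4 : ℂ))
    have i5 := int5.const_smul (a := z ^ 4)
    rw [e, circleIntegral.integral_sub, circleIntegral.integral_sub,
      circleIntegral.integral_const_mul, circleIntegral.integral_const_mul,
      circleIntegral.integral_add, circleIntegral.integral_add, circleIntegral.integral_add,
      cauchy _ m0, cauchy _ m1, cauchy _ m2, cauchy _ m3, cauchy _ m4, smul_eq_mul]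
    · field_simp
    exacts [int m1, int m2, i12, int m3, i123, int m4, i1234, int m0, i1234.sub (int m0), i5]
  rw [key]
  refine (circleIntegral.norm_two_pi_i_inv_smul_integral_le_of_norm_le_const
    (C := 2 * A * (‖z‖ / R) ^ 8 / R) hR.le fun ζ hζ => ?_).trans_eq (by field_simp)
  have hζR : ‖ζ‖ = R := by simpa using hζ
  have hden : R ^ 4 / 2 ≤ ‖ζ ^ 4 - z ^ 4‖ := by
    have h1 := norm_sub_norm_le (ζ ^ 4) (z ^ 4)
    have h2 : ‖z ^ 4‖ ≤ (R / 2) ^ 4 := by rw [norm_pow]; gcongr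
    rw [norm_pow, hζR] at h1
    have : 0 < R ^ 4 := by positivity
    nlinarith
  rw [norm_mul, norm_mul, norm_inv, norm_mul, norm_pow, norm_pow, hζR]
  calc ‖z‖ ^ 8 * (R ^ 5 * ‖ζ ^ 4 - z ^ 4‖)⁻¹ * ‖h ζ‖
      ≤ ‖z‖ ^ 8 * (R ^ 5 * (R ^ 4 / 2))⁻¹ * A := by
        gcongr
        exact hA ζ hζ
    _ = 2 * A * (‖z‖ / R) ^ 8 / R := by field_simp

/-- The version of `exists_average_rotation_sub_le` for functions with positive real part. -/
theorem exists_average_rotation_sub_le_of_re_pos {h : ℂ → ℂ} {S : ℝ} (hS : 0 < S)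
    (hd : DifferentiableOn ℂ h (Metric.ball 0 S)) (hpos : ∀ w ∈ Metric.ball 0 S, 0 < (h w).re) :
    ∃ b : ℂ, ∀ z : ℂ, ‖z‖ ≤ S / 4 →
      ‖(h z + h (Complex.I * z) + h (-z) + h (-(Complex.I * z))) / 4 - h 0 - b * z ^ 4‖ ≤
        1536 * ‖h 0‖ * (‖z‖ / S) ^ 8 := by
  -- Radius S/2 and bound A = 3‖h 0‖ give the constant 2 · 3 · 2⁸ = 1536.
  obtain ⟨b, hb⟩ := exists_average_rotation_sub_le (half_pos hS)
    (hd.mono (Metric.closedBall_subset_ball (by linarith)))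
    (fun z hz => norm_le_of_re_pos hd hpos hS (by simpa using hz.le))
  refine ⟨b, fun z hz => (hb z (by linarith)).trans_eq ?_⟩
  field_simp
  ring

/-! ### Choice of scales. -/

open Filter in
/-- Two scales `η, η'` at which opposite bounds for the same real number cannot both hold. -/
theorem exists_scales_incompatible {a b κ c : ℝ} (ha : 0 < a) :
    ∃ η η' ε : ℝ, 0 < η ∧ η ≤ 1 / 4 ∧ 0 < η' ∧ η' ≤ 1 / 4 ∧ 0 < ε ∧ ε ≤ 1 ∧
      ∀ y : ℝ, a * η ^ 6 - c * ε - κ * η ^ 8 ≤ -y * η ^ 4 →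
        ¬ -b * η' ^ 6 - c * ε - κ * η' ^ 8 ≤ y * η' ^ 4 := by
  have hsmall : ∀ᶠ x : ℝ in 𝓝[>] 0, 0 < x ∧ x ≤ 1 / 4 := by
    filter_upwards [Ioo_mem_nhdsGT (show (0 : ℝ) < 1 / 4 by norm_num)] with x hx
    exact ⟨hx.1, hx.2.le⟩
  have lim {f : ℝ → ℝ} (hf : Continuous f) : Tendsto f (𝓝[>] 0) (𝓝 (f 0)) :=
    (hf.tendsto 0).mono_left nhdsWithin_le_nhds
  -- η makes a η² dominate κ η⁴; then η' is small relative to the surplus, and ε relative to both.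
  have e1 : ∀ᶠ x : ℝ in 𝓝[>] 0, 0 < a - κ * x ^ 2 :=
    (lim (f := fun x => a - κ * x ^ 2) (by fun_prop)).eventually_const_lt (by simpa)
  obtain ⟨η, hη, hη1⟩ := (hsmall.and e1).exists
  have e2 : ∀ᶠ x : ℝ in 𝓝[>] 0, b * x ^ 2 + κ * x ^ 4 < a * η ^ 2 - κ * η ^ 4 :=
    (lim (f := fun x => b * x ^ 2 + κ * x ^ 4) (by fun_prop)).eventually_lt_const (by
      have := mul_pos (pow_pos hη.1 2) hη1
      simp; linarith)
  obtain ⟨η', hη', hη'1⟩ := (hsmall.and e2).exists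
  have e3 : ∀ᶠ x : ℝ in 𝓝[>] 0, b * η' ^ 2 + κ * η' ^ 4 + c * x / η' ^ 4 <
      a * η ^ 2 - κ * η ^ 4 - c * x / η ^ 4 := by
    have := lim (f := fun x => a * η ^ 2 - κ * η ^ 4 - c * x / η ^ 4 -
      (b * η' ^ 2 + κ * η' ^ 4 + c * x / η' ^ 4)) (by fun_prop)
    filter_upwards [this.eventually_const_lt (show (0 : ℝ) < _ by simp; linarith)] with x hx
    linarith
  obtain ⟨ε, hε, hε1⟩ := (hsmall.and e3).exists
  refine ⟨η, η', ε, hη.1, hη.2, hη'.1, hη'.2, hε.1, by linarith [hε.2], fun y h1 h2 => ?_⟩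
  have hη0 := hη.1
  have hη'0 := hη'.1
  have h3 : a * η ^ 2 - κ * η ^ 4 - c * ε / η ^ 4 ≤ -y := by
    rw [← mul_le_mul_iff_left₀ (pow_pos hη0 4)]
    refine le_trans (le_of_eq ?_) h1
    field_simp
    ring
  have h4 : -(b * η' ^ 2 + κ * η' ^ 4 + c * ε / η' ^ 4) ≤ y := by
    rw [← mul_le_mul_iff_left₀ (pow_pos hη'0 4)]
    refine le_trans (le_of_eq ?_) h2
    field_simp
    ring
  linarith

/-! ### Slices of the domain and the slope in the w-direction. -/

theorem fornaessFunction_zero (t : ℝ) : fornaessFunction t 0 = 0 := by simp [fornaessFunction]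

theorem fornaessFunction_vec (t : ℝ) (z w : ℂ) : fornaessFunction t ![z, w] =
    w.re + ‖z‖ ^ 6 + t * ‖z‖ ^ 2 * (z ^ 4).re + ‖z‖ ^ 2 * ‖w‖ ^ 2 := by
  simp [fornaessFunction, mul_pow]

theorem norm_vec_lt {z w : ℂ} {δ : ℝ} (hδ : 0 < δ) (hz : ‖z‖ < δ) (hw : ‖w‖ < δ) :
    ‖![z, w]‖ < δ := by
  rw [pi_norm_lt_iff hδ]
  intro j
  fin_cases j
  · exact hz
  · exact hw

/-- For fixed z the function is a constant plus Re w + |z|²|w|², convex in w. Convexity permits the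
mean value inequality on the slice. -/
theorem convex_fornaessFunction_vec_neg (t : ℝ) (z : ℂ) (δ : ℝ) :
    Convex ℝ {w : ℂ | fornaessFunction t ![z, w] < 0 ∧ ‖w‖ < δ} := by
  have h1 : ConvexOn ℝ univ (fun w : ℂ => ‖w‖ ^ 2) :=
    (convexOn_univ_norm).pow (fun _ _ => norm_nonneg _) 2
  have h2 : ConvexOn ℝ univ (fun w : ℂ => w.re) := Complex.reLm.convexOn convex_univ
  have h3 : ConvexOn ℝ univ (fun w : ℂ => fornaessFunction t ![z, w]) := by
    have := ((h2.add_const (‖z‖ ^ 6 + t * ‖z‖ ^ 2 * (z ^ 4).re)).add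
      (h1.smul (sq_nonneg ‖z‖)))
    refine this.congr fun w _ => ?_
    simp [fornaessFunction_vec]
    ring
  have e : {w : ℂ | fornaessFunction t ![z, w] < 0 ∧ ‖w‖ < δ} =
      {w ∈ univ | fornaessFunction t ![z, w] < 0} ∩ Metric.ball 0 δ := by
    ext w
    simp only [mem_ofPred_eq, mem_inter_iff, mem_univ, true_and, mem_ball_zero_iff]
  rw [e]
  exact (h3.convex_lt 0).inter (convex_ball (0 : ℂ) δ)

/-- For `f` of class `C¹` up to the boundary, the increments of `f` along the `w`-direction inside
the domain are approximately linear near the origin, with a uniform slope. -/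
theorem MemA.exists_slope {t δ₀ : ℝ} {G : Set (Fin 2 → ℂ)} {f : (Fin 2 → ℂ) → ℂ} (hG : IsOpen G)
    (hδ₀ : 0 < δ₀) (hGr : ∀ p, ‖p‖ < δ₀ → fornaessFunction t p < 0 → p ∈ G)
    (hf : MemA 1 G f) (h0 : 0 ∈ closure G) :
    ∃ B : ℂ, ∀ ε > 0, ∃ δ > 0, δ ≤ δ₀ ∧ ∀ z w₀ w₁ : ℂ, ‖z‖ < δ → ‖w₀‖ < δ → ‖w₁‖ < δ →
      fornaessFunction t ![z, w₀] < 0 → fornaessFunction t ![z, w₁] < 0 →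
      ‖f ![z, w₁] - f ![z, w₀] - B * (w₁ - w₀)‖ ≤ ε * ‖w₁ - w₀‖ := by
  obtain ⟨F, hF, hFf⟩ := hf.exists_extension 1 le_rfl
  let e : Fin 2 → ℂ := Pi.single 1 1
  have hcont : ContinuousWithinAt (fun p => F p (fun _ => e)) (closure G) 0 := by
    have := hF 0 h0
    exact (ContinuousMultilinearMap.apply ℝ (fun _ : Fin 1 => Fin 2 → ℂ) ℂ
      (fun _ => e)).continuous.continuousAt.comp_continuousWithinAt this
  refine ⟨F 0 (fun _ => e), fun ε hε => ?_⟩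
  obtain ⟨δ, hδ, hclose⟩ := Metric.continuousWithinAt_iff.mp hcont ε hε
  refine ⟨min δ δ₀, by positivity, min_le_right _ _, fun z w₀ w₁ hz hw₀ hw₁ hr₀ hr₁ => ?_⟩
  have hs := convex_fornaessFunction_vec_neg t z (min δ δ₀)
  have hder : ∀ w ∈ {w : ℂ | fornaessFunction t ![z, w] < 0 ∧ ‖w‖ < min δ δ₀},
      HasDerivWithinAt (fun w => f ![z, w] - F 0 (fun _ => e) * w)
        (fderiv ℝ f ![z, w] e - F 0 (fun _ => e) * 1)
        {w : ℂ | fornaessFunction t ![z, w] < 0 ∧ ‖w‖ < min δ δ₀} w := by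
    intro w hw
    have hp := norm_vec_lt (by positivity) hz hw.2
    have hpG := hGr _ (hp.trans_le (min_le_right _ _)) hw.1
    have hfd := hf.holomorphic.differentiableAt (hG.mem_nhds hpG)
    rw [hfd.fderiv_restrictScalars ℝ]
    have hv : HasDerivAt (fun w : ℂ => ![z, w]) e w := by
      rw [hasDerivAt_pi]
      intro j
      fin_cases j
      · simpa [e] using hasDerivAt_const w z
      · have he : e 1 = 1 := by simp [e]
        change HasDerivAt (fun w : ℂ => w) (e 1) w
        rw [he]
        exact hasDerivAt_id' w
    exact ((hfd.hasFDerivAt.comp_hasDerivAt w hv).sub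
      ((hasDerivAt_id w).const_mul _)).hasDerivWithinAt
  have hbound : ∀ w ∈ {w : ℂ | fornaessFunction t ![z, w] < 0 ∧ ‖w‖ < min δ δ₀},
      ‖fderiv ℝ f ![z, w] e - F 0 (fun _ => e) * 1‖ ≤ ε := by
    intro w hw
    have hp := norm_vec_lt (by positivity) hz hw.2
    have hpG := hGr _ (hp.trans_le (min_le_right _ _)) hw.1
    have := hclose (subset_closure hpG) (by
      rw [dist_zero_right]; exact hp.trans_le (min_le_left _ _))
    rw [hFf hpG, iteratedFDeriv_one_apply, dist_eq_norm] at this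
    simpa using this.le
  have := hs.norm_image_sub_le_of_norm_hasDerivWithin_le hder hbound ⟨hr₀, hw₀⟩ ⟨hr₁, hw₁⟩
  refine le_trans (le_of_eq ?_) this
  congr 1
  ring

/-- Rotation averages of the restriction of `h` to a level `w = -2 (1 + t) S⁶` are governed by a
single fourth-order coefficient, and positivity of `Re h` bounds it from below at every point
`(z, w)` of the domain with `w` real. -/
theorem exists_fourth_coeff {t δ ε S : ℝ} {B : ℂ} {h : (Fin 2 → ℂ) → ℂ} (ht : 0 < t) (hε : 0 ≤ ε)
    (hd : DifferentiableOn ℂ h {p | ‖p‖ < δ ∧ fornaessFunction t p < 0})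
    (hpos : ∀ p, ‖p‖ < δ → fornaessFunction t p < 0 → 0 < (h p).re)
    (hinc : ∀ z w₀ w₁ : ℂ, ‖z‖ < δ → ‖w₀‖ < δ → ‖w₁‖ < δ →
      fornaessFunction t ![z, w₀] < 0 → fornaessFunction t ![z, w₁] < 0 →
      ‖h ![z, w₁] - h ![z, w₀] + B * (w₁ - w₀)‖ ≤ ε * ‖w₁ - w₀‖)
    (hax : ∀ τ : ℝ, 0 < τ → τ < δ → ‖h ![0, -(τ : ℂ)] - B * τ‖ ≤ ε * τ)
    (hS : 0 < S) (hSδ : S < δ) (hMδ : 2 * (1 + t) * S ^ 6 < δ)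
    (hMS : (2 * (1 + t)) ^ 2 * S ^ 8 < 1 + t) :
    ∃ b : ℂ, ∀ z : ℂ, ∀ w : ℝ, ‖z‖ ≤ S / 4 → |w| ≤ 2 * (1 + t) * S ^ 6 →
      fornaessFunction t ![z, w] < 0 →
      B.re * w - 3 * ε * (2 * (1 + t) * S ^ 6) -
        1536 * ((‖B‖ + ε) * (2 * (1 + t) * S ^ 6)) * (‖z‖ / S) ^ 8 ≤ (b * z ^ 4).re := by
  -- Half of m absorbs (1 + t)S⁶, which bounds the terms of degree six; the other half absorbs |zw|²
  -- ≤ S²m².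
  set m := 2 * (1 + t) * S ^ 6 with hm
  have hm0 : 0 < m := by positivity
  have hδ : 0 < δ := hS.trans hSδ
  have hnm : ‖-(m : ℂ)‖ < δ := by simpa [abs_of_pos hm0] using hMδ
  have hneg : ∀ z : ℂ, ‖z‖ ≤ S → fornaessFunction t ![z, -(m : ℂ)] < 0 := by
    intro z hz
    rw [fornaessFunction_vec, norm_neg, Complex.norm_real, Real.norm_eq_abs, sq_abs]
    have h4 := (Complex.re_le_norm (z ^ 4)).trans_eq (norm_pow _ _)
    have h5 : t * ‖z‖ ^ 2 * (z ^ 4).re ≤ t * ‖z‖ ^ 2 * ‖z‖ ^ 4 := by gcongr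
    have h6 : ‖z‖ ^ 6 ≤ S ^ 6 := by gcongr
    have h7 : ‖z‖ ^ 2 * m ^ 2 ≤ S ^ 2 * m ^ 2 := by gcongr
    have h8 : S ^ 2 * m ^ 2 < S ^ 6 * (1 + t) := by
      have := mul_lt_mul_of_pos_left hMS (pow_pos hS 6)
      rw [hm]
      linarith
    have h9 : t * ‖z‖ ^ 6 ≤ t * S ^ 6 := by gcongr
    simp only [Complex.neg_re, Complex.ofReal_re]
    nlinarith
  set k : ℂ → ℂ := fun z => h ![z, -(m : ℂ)] with hk
  have hkd : DifferentiableOn ℂ k (Metric.ball 0 S) := by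
    refine hd.comp (t := {p | ‖p‖ < δ ∧ fornaessFunction t p < 0}) ?_ fun z hz => ?_
    · refine Differentiable.differentiableOn ?_
      rw [differentiable_pi]
      intro j
      fin_cases j
      · exact differentiable_id
      · exact differentiable_const _
    · have hz' : ‖z‖ < S := by simpa using hz
      exact ⟨norm_vec_lt hδ (hz'.trans hSδ) hnm, hneg z hz'.le⟩
  have hkpos : ∀ z ∈ Metric.ball 0 S, 0 < (k z).re := by
    intro z hz
    have hz' : ‖z‖ < S := by simpa using hz
    exact hpos _ (norm_vec_lt hδ (hz'.trans hSδ) hnm) (hneg z hz'.le)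
  obtain ⟨b, hb⟩ := exists_average_rotation_sub_le_of_re_pos hS hkd hkpos
  have hk0 : ‖k 0 - B * m‖ ≤ ε * m := hax m hm0 hMδ
  have hk0n : ‖k 0‖ ≤ (‖B‖ + ε) * m := by
    have h1 := norm_le_norm_add_norm_sub' (k 0) (B * m)
    rw [norm_mul, Complex.norm_real, Real.norm_of_nonneg hm0.le] at h1
    linarith
  have hk0re : (k 0).re ≤ B.re * m + ε * m := by
    have h1 := (Complex.re_le_norm (k 0 - B * m)).trans hk0
    simp at h1
    linarith
  refine ⟨b, fun z w hz hw hr => ?_⟩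
  -- r depends on z only through |z| and z⁴, so (x, w) stays in the domain for every x in the
  -- rotation orbit of z.
  have hmono : ∀ x : ℂ, ‖x‖ = ‖z‖ → x ^ 4 = z ^ 4 → B.re * (w + m) - 2 * ε * m ≤ (k x).re := by
    intro x hx hx4
    have hxS : ‖x‖ < δ := by linarith
    have hrx : fornaessFunction t ![x, (w : ℂ)] < 0 := by
      rwa [fornaessFunction_vec, hx, hx4, ← fornaessFunction_vec]
    have hwδ : ‖(w : ℂ)‖ < δ := by
      rw [Complex.norm_real]; exact hw.trans_lt hMδ
    have h1 := hinc x (-(m : ℂ)) w hxS hnm hwδ (hneg x (by linarith)) hrx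
    have h2 := hpos _ (norm_vec_lt hδ hxS hwδ) hrx
    have h3 := (Complex.re_le_norm _).trans h1
    have h4 : ‖(w : ℂ) - -(m : ℂ)‖ ≤ 2 * m := by
      refine (norm_sub_le _ _).trans ?_
      rw [norm_neg, Complex.norm_real, Complex.norm_real, Real.norm_of_nonneg hm0.le]
      have : ‖w‖ ≤ m := hw
      linarith
    have h5 := mul_le_mul_of_nonneg_left h4 hε
    rw [sub_neg_eq_add] at h5
    simp at h3
    simp only [hk]
    linarith
  have h1 := hmono z rfl rfl
  have h2 := hmono (Complex.I * z) (by simp) (by rw [mul_pow, Complex.I_pow_four, one_mul])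
  have h3 := hmono (-z) (by simp) (by ring)
  have h4 := hmono (-(Complex.I * z)) (by simp)
    (by rw [neg_pow, mul_pow, Complex.I_pow_four]; ring)
  have h5 := (Complex.re_le_norm _).trans (hb z hz)
  have h6 : 1536 * ‖k 0‖ * (‖z‖ / S) ^ 8 ≤ 1536 * ((‖B‖ + ε) * m) * (‖z‖ / S) ^ 8 := by gcongr
  have h7 : ((k z + k (Complex.I * z) + k (-z) + k (-(Complex.I * z))) / 4).re =
      ((k z).re + (k (Complex.I * z)).re + (k (-z)).re + (k (-(Complex.I * z))).re) / 4 := by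
    simp only [Complex.div_ofNat_re, Complex.add_re]
  rw [Complex.sub_re, Complex.sub_re, h7] at h5
  linarith

theorem fornaessFunction_zero_vec (t : ℝ) (w : ℂ) : fornaessFunction t ![0, w] = w.re := by
  simp [fornaessFunction_vec]

/-- The Hopf lemma on the slice `z = 0`. -/
theorem slope_re_pos {t δ₀ : ℝ} {B : ℂ} {h : (Fin 2 → ℂ) → ℂ} (hδ₀ : 0 < δ₀)
    (hd : DifferentiableOn ℂ h {p | ‖p‖ < δ₀ ∧ fornaessFunction t p < 0})
    (hpos : ∀ p, ‖p‖ < δ₀ → fornaessFunction t p < 0 → 0 < (h p).re)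
    (hax : ∀ ε > 0, ∃ δ > 0, ∀ τ : ℝ, 0 < τ → τ < δ → ‖h ![0, -(τ : ℂ)] - B * τ‖ ≤ ε * τ) :
    0 < B.re := by
  set R := δ₀ / 2 with hR
  have hR0 : 0 < R := by positivity
  -- The slice z = 0 is a half-disc of Re w < 0; this disc touches its boundary at 0.
  have hball : ∀ w ∈ Metric.ball (-(R : ℂ)) R,
      ‖![0, w]‖ < δ₀ ∧ fornaessFunction t ![0, w] < 0 := by
    intro w hw
    rw [mem_ball_iff_norm, sub_neg_eq_add] at hw
    refine ⟨norm_vec_lt hδ₀ (by simpa) ?_, ?_⟩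
    · have := norm_sub_le (w + R) R
      rw [add_sub_cancel_right, Complex.norm_real, Real.norm_of_nonneg hR0.le] at this
      linarith
    · have := (Complex.re_le_norm _).trans_lt hw
      rw [fornaessFunction_zero_vec]
      simp at this
      linarith
  have hkd : DifferentiableOn ℂ (fun w : ℂ => h ![0, w]) (Metric.ball (-(R : ℂ)) R) := by
    refine hd.comp (t := {p | ‖p‖ < δ₀ ∧ fornaessFunction t p < 0}) ?_ hball
    refine Differentiable.differentiableOn ?_
    rw [differentiable_pi]
    intro j
    fin_cases j
    · exact differentiable_const _
    · exact differentiable_id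
  have hkpos : ∀ w ∈ Metric.ball (-(R : ℂ)) R, 0 < (h ![0, w]).re := fun w hw =>
    hpos _ (hball w hw).1 (hball w hw).2
  have ha := hkpos _ (Metric.mem_ball_self hR0)
  set a := (h ![0, -(R : ℂ)]).re
  -- The Harnack bound at -τ is aτ/(4R), so an error of half that size leaves Re B positive.
  obtain ⟨δ, hδ, hax⟩ := hax (a / (8 * R)) (by positivity)
  obtain ⟨τ, hτ0, hτ⟩ := exists_between (lt_min hδ hR0)
  have hτR := hτ.trans_le (min_le_right _ _)
  have hdist : dist (-(τ : ℂ)) (-(R : ℂ)) = R - τ := by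
    rw [dist_neg_neg, dist_comm, Complex.dist_eq, ← Complex.ofReal_sub, Complex.norm_real,
      Real.norm_of_nonneg (by linarith)]
  have h1 := le_re_of_re_pos hkd hkpos
    (show -(τ : ℂ) ∈ _ by rw [Metric.mem_ball, hdist]; linarith)
  rw [hdist] at h1
  have h2 := (Complex.re_le_norm _).trans (hax τ hτ0 (hτ.trans_le (min_le_left _ _)))
  simp at h2
  have h3 : τ / R ≤ 1 - ((R - τ) / R) ^ 2 := by
    have h4 : (R - τ) / R = 1 - τ / R := by field_simp
    have h5 : τ / R ≤ 1 := (div_le_one hR0).mpr hτR.le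
    have h6 : 0 ≤ τ / R := by positivity
    rw [h4]
    nlinarith
  have h7 : τ / R * a / 4 ≤ (h ![0, -(τ : ℂ)]).re := le_trans (by gcongr) h1
  have h8 : a / (8 * R) * τ = τ / R * a / 8 := by field_simp
  have h9 : 0 < τ / R * a := by positivity
  have h10 : 0 < B.re * τ := by linarith
  exact pos_of_mul_pos_left h10 hτ0.le

/-- For `t > 1` no holomorphic function with positive real part near the origin has an approximately
constant slope `-B` with `Re B > 0` in the `w`-direction. -/
theorem not_re_pos_of_slope {t δ₀ : ℝ} {B : ℂ} {h : (Fin 2 → ℂ) → ℂ} (ht : 1 < t)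
    (hd : DifferentiableOn ℂ h {p | ‖p‖ < δ₀ ∧ fornaessFunction t p < 0})
    (hpos : ∀ p, ‖p‖ < δ₀ → fornaessFunction t p < 0 → 0 < (h p).re) (hB : 0 < B.re)
    (hinc : ∀ ε > 0, ∃ δ > 0, δ ≤ δ₀ ∧ ∀ z w₀ w₁ : ℂ, ‖z‖ < δ → ‖w₀‖ < δ → ‖w₁‖ < δ →
      fornaessFunction t ![z, w₀] < 0 → fornaessFunction t ![z, w₁] < 0 →
      ‖h ![z, w₁] - h ![z, w₀] + B * (w₁ - w₀)‖ ≤ ε * ‖w₁ - w₀‖)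
    (hax : ∀ ε > 0, ∃ δ > 0, ∀ τ : ℝ, 0 < τ → τ < δ → ‖h ![0, -(τ : ℂ)] - B * τ‖ ≤ ε * τ) :
    False := by
  -- η, η' and ε depend only on t and B; S is chosen afterwards, small in terms of ε. The 1 in κ
  -- absorbs ε ≤ 1.
  obtain ⟨η, η', ε, hη0, hη, hη'0, hη', hε0, hε1, hfalse⟩ := exists_scales_incompatible
    (a := B.re * ((t - 1) / 2)) (b := B.re * (2 * (1 + t)))
    (κ := 1536 * ((‖B‖ + 1) * (2 * (1 + t)))) (c := 3 * (2 * (1 + t)))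
    (mul_pos hB (by linarith))
  obtain ⟨δ₁, hδ₁, hδ₁₀, hinc⟩ := hinc ε hε0
  obtain ⟨δ₂, hδ₂, hax⟩ := hax ε hε0
  have ev : ∀ᶠ S : ℝ in 𝓝[>] 0, 0 < S ∧ S < min δ₁ δ₂ ∧ 2 * (1 + t) * S ^ 6 < min δ₁ δ₂ ∧
      (2 * (1 + t)) ^ 2 * S ^ 8 < 1 + t := by
    have lim {f : ℝ → ℝ} (hf : Continuous f) : Filter.Tendsto f (𝓝[>] 0) (𝓝 (f 0)) :=
      (hf.tendsto 0).mono_left nhdsWithin_le_nhds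
    have hm : 0 < min δ₁ δ₂ := lt_min hδ₁ hδ₂
    have h8 : (2 * (1 + t)) ^ 2 * (0 : ℝ) ^ 8 < 1 + t := by simp; linarith
    have h6 : 2 * (1 + t) * (0 : ℝ) ^ 6 < min δ₁ δ₂ := by simpa using hm
    filter_upwards [self_mem_nhdsWithin, (lim continuous_id).eventually_lt_const hm,
      (lim (f := fun S => 2 * (1 + t) * S ^ 6) (by fun_prop)).eventually_lt_const h6,
      (lim (f := fun S => (2 * (1 + t)) ^ 2 * S ^ 8) (by fun_prop)).eventually_lt_const h8]
      with S h1 h2 h3 h4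
    exact ⟨h1, h2, h3, h4⟩
  obtain ⟨S, hS, hSδ, hSm, hS8⟩ := ev.exists
  have hδ : min δ₁ δ₂ ≤ δ₁ := min_le_left _ _
  have hle (x : ℝ) (hx : x < min δ₁ δ₂) : x < δ₁ := hx.trans_le hδ
  obtain ⟨b, hb⟩ := exists_fourth_coeff (δ := min δ₁ δ₂) (ε := ε) (B := B) (h := h) (by linarith)
    hε0.le (hd.mono fun p hp => ⟨(hle _ hp.1).trans_le hδ₁₀, hp.2⟩)
    (fun p hp => hpos p ((hle _ hp).trans_le hδ₁₀))
    (fun z w₀ w₁ hz hw₀ hw₁ => hinc z w₀ w₁ (hle _ hz) (hle _ hw₀) (hle _ hw₁))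
    (fun τ hτ0 hτ => hax τ hτ0 (hτ.trans_le (min_le_right _ _))) hS hSδ hSm hS8
  have hSη {x : ℝ} (hx0 : 0 < x) (hx : x ≤ 1 / 4) :
      (x * S) ^ 6 ≤ S ^ 6 ∧ (2 * (1 + t)) ^ 2 * (x * S) ^ 8 < 1 + t := by
    have hxS : x * S ≤ S := by nlinarith
    refine ⟨by gcongr, lt_of_le_of_lt ?_ hS8⟩
    gcongr
  have herr {x : ℝ} (hx0 : 0 < x) (hx : x ≤ 1 / 4) {w : ℝ} (hw : |w| ≤ 2 * (1 + t) * S ^ 6) {z : ℂ}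
      (hz : ‖z‖ = x * S) (hr : fornaessFunction t ![z, (w : ℂ)] < 0) :
      B.re * w - 3 * (2 * (1 + t)) * ε * S ^ 6 -
        1536 * ((‖B‖ + 1) * (2 * (1 + t))) * x ^ 8 * S ^ 6 ≤ (b * z ^ 4).re := by
    have h1 := hb z w (by rw [hz]; nlinarith) hw hr
    rw [hz, mul_div_cancel_right₀ _ hS.ne'] at h1
    have h2 : 1536 * ((‖B‖ + ε) * (2 * (1 + t) * S ^ 6)) * x ^ 8 ≤
        1536 * ((‖B‖ + 1) * (2 * (1 + t) * S ^ 6)) * x ^ 8 := by gcongr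
    linarith
  -- After division by S⁶ the coefficient b enters only through Re b / S².
  refine hfalse (b.re / S ^ 2) ?_ ?_
  · obtain ⟨u, hu, hu4⟩ : ∃ u : ℂ, ‖u‖ = 1 ∧ u ^ 4 = -1 := by
      refine ⟨Complex.exp ((Real.pi / 4 : ℝ) * Complex.I), Complex.norm_exp_ofReal_mul_I _, ?_⟩
      rw [← Complex.exp_nat_mul, ← Complex.exp_pi_mul_I]
      push_cast
      congr 1
      ring
    obtain ⟨h6, h8⟩ := hSη hη0 hη
    set s := η * S with hs
    have hs0 : 0 < s := by positivity
    have hz : ‖(s : ℂ) * u‖ = s := by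
      rw [norm_mul, hu, Complex.norm_real, Real.norm_of_nonneg hs0.le, mul_one]
    have hz4 : ((s : ℂ) * u) ^ 4 = ((-s ^ 4 : ℝ) : ℂ) := by
      rw [mul_pow, hu4]; push_cast; ring
    -- On z⁴ = -s⁴ the terms of degree six in z sum to -(t - 1)s⁶, so w may use half of that room,
    -- the rest absorbing |zw|².
    have hr : fornaessFunction t ![(s : ℂ) * u, (((t - 1) / 2 * s ^ 6 : ℝ) : ℂ)] < 0 := by
      rw [fornaessFunction_vec, hz, hz4, Complex.ofReal_re, Complex.ofReal_re, Complex.norm_real,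
        Real.norm_eq_abs, sq_abs]
      have h9 : (t - 1) / 2 * s ^ 8 < 1 := by
        have : 0 < s ^ 8 := by positivity
        nlinarith
      have h10 : 0 < (t - 1) / 2 * s ^ 6 := by
        have : 0 < t - 1 := by linarith
        positivity
      nlinarith [mul_lt_mul_of_pos_left h9 h10]
    have hw : |(t - 1) / 2 * s ^ 6| ≤ 2 * (1 + t) * S ^ 6 := by
      rw [abs_of_nonneg (mul_nonneg (by linarith) (by positivity))]
      have : 0 < S ^ 6 := by positivity
      nlinarith
    have := herr hη0 hη hw hz hr
    rw [hz4, Complex.re_mul_ofReal] at this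
    rw [← mul_le_mul_iff_left₀ (pow_pos hS 6)]
    have e : -(b.re / S ^ 2) * η ^ 4 * S ^ 6 = b.re * -s ^ 4 := by rw [hs]; field_simp
    rw [e]
    refine le_trans (le_of_eq ?_) this
    rw [hs]
    ring
  · obtain ⟨h6, h8⟩ := hSη hη'0 hη'
    set s := η' * S with hs
    have hs0 : 0 < s := by positivity
    have hz : ‖(s : ℂ)‖ = s := by rw [Complex.norm_real, Real.norm_of_nonneg hs0.le]
    have hz4 : (s : ℂ) ^ 4 = ((s ^ 4 : ℝ) : ℂ) := by push_cast; ring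
    have hr : fornaessFunction t ![(s : ℂ), ((-(2 * (1 + t) * s ^ 6) : ℝ) : ℂ)] < 0 := by
      rw [fornaessFunction_vec, hz, hz4, Complex.ofReal_re, Complex.ofReal_re, Complex.norm_real,
        Real.norm_eq_abs, sq_abs]
      nlinarith [mul_lt_mul_of_pos_left h8 (pow_pos hs0 6)]
    have hw : |-(2 * (1 + t) * s ^ 6)| ≤ 2 * (1 + t) * S ^ 6 := by
      rw [abs_neg, abs_of_nonneg (by positivity)]
      gcongr
    have := herr hη'0 hη' hw hz hr
    rw [hz4, Complex.re_mul_ofReal] at this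
    rw [← mul_le_mul_iff_left₀ (pow_pos hS 6)]
    have e : b.re / S ^ 2 * η' ^ 4 * S ^ 6 = b.re * s ^ 4 := by rw [hs]; field_simp
    rw [e]
    refine le_trans (le_of_eq ?_) this
    rw [hs]
    ring

/-! ### From a peak function to the contradiction, and boundary points. -/

theorem tendsto_neg_axis :
    Filter.Tendsto (fun τ : ℝ => ![0, -(τ : ℂ)]) (𝓝[>] 0) (𝓝 0) := by
  have hc : Continuous (fun τ : ℝ => ![0, -(τ : ℂ)]) := by fun_prop
  have := (hc.tendsto 0).mono_left (nhdsWithin_le_nhds (s := Ioi 0))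
  have e : ![0, -((0 : ℝ) : ℂ)] = 0 := by ext j; fin_cases j <;> simp
  rwa [e] at this

theorem not_isPeakPoint {t δ₀ : ℝ} {G : Set (Fin 2 → ℂ)} (ht : 1 < t) (hG : IsOpen G)
    (hδ₀ : 0 < δ₀) (hGr : ∀ p, ‖p‖ < δ₀ → fornaessFunction t p < 0 → p ∈ G) :
    ¬ IsPeakPoint 1 G 0 := by
  rintro ⟨f, hf, hf0, hlt⟩
  have hax0 {τ : ℝ} (hτ0 : 0 < τ) (hτ : τ < δ₀) :
      fornaessFunction t ![0, -(τ : ℂ)] < 0 ∧ ‖![0, -(τ : ℂ)]‖ < δ₀ := by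
    rw [fornaessFunction_zero_vec]
    exact ⟨by simpa, norm_vec_lt hδ₀ (by simpa) (by simpa [abs_of_pos hτ0])⟩
  have htend : Filter.Tendsto (fun τ : ℝ => ![0, -(τ : ℂ)]) (𝓝[>] 0) (𝓝[G] 0) := by
    refine tendsto_nhdsWithin_iff.mpr ⟨?_, ?_⟩
    · exact tendsto_neg_axis
    · filter_upwards [Ioo_mem_nhdsGT hδ₀] with τ hτ
      exact hGr _ (hax0 hτ.1 hτ.2).2 (hax0 hτ.1 hτ.2).1
  have h0 : 0 ∈ closure G := by
    rw [mem_closure_iff_nhdsWithin_neBot]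
    exact htend.neBot
  obtain ⟨B, hB⟩ := hf.exists_slope hG hδ₀ hGr h0
  have hd : DifferentiableOn ℂ (fun p => 1 - f p) {p | ‖p‖ < δ₀ ∧ fornaessFunction t p < 0} :=
    (hf.holomorphic.mono fun p hp => hGr p hp.1 hp.2).const_sub 1
  have hpos : ∀ p, ‖p‖ < δ₀ → fornaessFunction t p < 0 → 0 < (1 - f p).re := by
    intro p hp hr
    have hp0 : p ≠ 0 := by
      rintro rfl
      simp [fornaessFunction_zero] at hr
    have := (Complex.re_le_norm _).trans_lt (hlt p ⟨subset_closure (hGr p hp hr), hp0⟩)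
    simpa using this
  have hinc : ∀ ε > 0, ∃ δ > 0, δ ≤ δ₀ ∧ ∀ z w₀ w₁ : ℂ, ‖z‖ < δ → ‖w₀‖ < δ → ‖w₁‖ < δ →
      fornaessFunction t ![z, w₀] < 0 → fornaessFunction t ![z, w₁] < 0 →
      ‖(1 - f ![z, w₁]) - (1 - f ![z, w₀]) + B * (w₁ - w₀)‖ ≤ ε * ‖w₁ - w₀‖ := by
    intro ε hε
    obtain ⟨δ, hδ, hδ₁, h⟩ := hB ε hε
    refine ⟨δ, hδ, hδ₁, fun z w₀ w₁ hz hw₀ hw₁ hr₀ hr₁ => ?_⟩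
    rw [← norm_neg]
    refine le_trans (le_of_eq ?_) (h z w₀ w₁ hz hw₀ hw₁ hr₀ hr₁)
    congr 1
    ring
  have hax : ∀ ε > 0, ∃ δ > 0, ∀ τ : ℝ, 0 < τ → τ < δ →
      ‖1 - f ![0, -(τ : ℂ)] - B * τ‖ ≤ ε * τ := by
    intro ε hε
    obtain ⟨δ, hδ, hδ₁, h⟩ := hB ε hε
    refine ⟨δ, hδ, fun τ hτ0 hτ => ?_⟩
    -- The estimate on the axis comes from the increment from -τ to -σ by letting σ tend to 0, where
    -- f tends to 1.
    have hft : Filter.Tendsto (fun σ : ℝ => f ![0, -(σ : ℂ)]) (𝓝[>] 0) (𝓝 1) := by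
      have := ((hf.continuousOn 0 h0).mono subset_closure).tendsto.comp htend
      rwa [hf0] at this
    have hσ : Filter.Tendsto (fun σ : ℝ => (σ : ℂ)) (𝓝[>] 0) (𝓝 0) := by
      have := (Complex.continuous_ofReal.tendsto 0).mono_left (nhdsWithin_le_nhds (s := Ioi 0))
      simpa using this
    have hl := ((hft.sub_const (f ![0, -(τ : ℂ)])).sub
      ((hσ.neg.sub_const (-(τ : ℂ))).const_mul B)).norm
    have hr := (hσ.neg.sub_const (-(τ : ℂ))).norm.const_mul ε
    have := le_of_tendsto_of_tendsto hl hr (by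
      filter_upwards [Ioo_mem_nhdsGT hδ] with σ hσ
      refine h 0 _ _ (by simpa) (by simpa [abs_of_pos hτ0]) (by simpa [abs_of_pos hσ.1] using hσ.2)
        (hax0 hτ0 (hτ.trans_le hδ₁)).1 (hax0 hσ.1 (hσ.2.trans_le hδ₁)).1)
    simpa [abs_of_pos hτ0] using this
  exact not_re_pos_of_slope ht hd hpos (slope_re_pos hδ₀ hd hpos hax) hinc hax

theorem zero_mem_frontier_of_fornaess {t : ℝ} {D U : Set (Fin 2 → ℂ)} (hU : IsOpen U)
    (h0U : 0 ∈ U) (hDU : D ∩ U = {p ∈ U | fornaessFunction t p < 0}) : 0 ∈ frontier D := by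
  refine ⟨?_, fun h => ?_⟩
  · refine mem_closure_of_tendsto tendsto_neg_axis ?_
    filter_upwards [tendsto_neg_axis.eventually (hU.mem_nhds h0U), self_mem_nhdsWithin]
      with τ hτU hτ
    have : ![0, -(τ : ℂ)] ∈ D ∩ U := by
      rw [hDU]
      refine ⟨hτU, ?_⟩
      rw [fornaessFunction_zero_vec]
      simpa using hτ
    exact this.1
  · have : (0 : Fin 2 → ℂ) ∈ D ∩ U := ⟨interior_subset h, h0U⟩
    rw [hDU] at this
    simpa [fornaessFunction_zero] using this.2

/-- Closure gives r ≤ 0 by continuity, and r < 0 would put p in the open set D, which misses its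
frontier. -/
theorem fornaessFunction_eq_zero_of_mem_frontier {t : ℝ} {D U : Set (Fin 2 → ℂ)} (hD : IsOpen D)
    (hU : IsOpen U) (hDU : D ∩ U = {p ∈ U | fornaessFunction t p < 0}) {p : Fin 2 → ℂ}
    (hp : p ∈ frontier D) (hpU : p ∈ U) : fornaessFunction t p = 0 := by
  rw [hD.frontier_eq] at hp
  refine le_antisymm ?_ (not_lt.mp fun h => hp.2 ?_)
  · have h1 : p ∈ closure (D ∩ U) := by
      rw [inter_comm]
      exact hU.inter_closure ⟨hpU, hp.1⟩
    have h2 : IsClosed {q | fornaessFunction t q ≤ 0} :=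
      isClosed_le (contDiff_fornaessFunction t).continuous continuous_const
    refine closure_minimal (fun q hq => ?_) h2 h1
    rw [hDU] at hq
    exact hq.2.le
  · have : p ∈ D ∩ U := by rw [hDU]; exact ⟨hpU, h⟩
    exact this.1

end SeveralComplex

theorem proposition3p3 (t : ℝ) (ht : 0 < t) (D : Set (Fin 2 → ℂ)) (hD : IsOpen D)
    (hD0 : ∃ U : Set (Fin 2 → ℂ), IsOpen U ∧ 0 ∈ U ∧
      D ∩ U = {p ∈ U | SeveralComplex.fornaessFunction t p < 0}) :
    0 ∈ frontier D ∧
    (t ≤ 9 / 5 → ∃ U : Set (Fin 2 → ℂ), IsOpen U ∧ 0 ∈ U ∧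
      (∀ p ∈ frontier D ∩ U, SeveralComplex.IsPseudoconvexAt D p) ∧
      (∀ p ∈ frontier D ∩ U, p ≠ 0 → SeveralComplex.IsStrictlyPseudoconvexAt D p)) ∧
    (1 < t → ¬ SeveralComplex.IsLocalPeakPoint 1 D 0) := by
  obtain ⟨U, hU, h0U, hDU⟩ := hD0
  refine ⟨SeveralComplex.zero_mem_frontier_of_fornaess hU h0U hDU, fun ht' => ?_, fun ht1 => ?_⟩
  · have hdef : SeveralComplex.IsDefiningFunctionOn D (U ∩ Metric.ball 0 (1 / 2))
        (SeveralComplex.fornaessFunction t) := by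
      refine ⟨hU.inter Metric.isOpen_ball, (SeveralComplex.contDiff_fornaessFunction t).contDiffOn,
        ?_, fun z hz => SeveralComplex.fderiv_fornaessFunction_ne_zero (by simpa using hz.2)⟩
      ext p
      have : p ∈ D ∩ U ↔ p ∈ U ∧ SeveralComplex.fornaessFunction t p < 0 := by rw [hDU]; rfl
      simp only [mem_inter_iff, mem_ofPred_eq] at this ⊢
      tauto
    refine ⟨U ∩ Metric.ball 0 (1 / 2), hdef.isOpen, ⟨h0U, by simp⟩, fun p hp => ?_,
      fun p hp hp0 => ?_⟩
    · exact ⟨hp.1, _, _, hp.2, hdef, fun v _ =>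
        SeveralComplex.leviForm_fornaessFunction_nonneg ht ht' p v⟩
    · exact ⟨hp.1, _, _, hp.2, hdef, fun v hv hv0 =>
        SeveralComplex.leviForm_fornaessFunction_pos ht ht' (by simpa using hp.2.2) hp0
          (SeveralComplex.fornaessFunction_eq_zero_of_mem_frontier hD hU hDU hp.1 hp.2.1) hv0 hv⟩
  · rintro ⟨V, hV, h0V, hpeak⟩
    obtain ⟨δ, hδ, hball⟩ := Metric.isOpen_iff.mp (hU.inter hV) 0 ⟨h0U, h0V⟩
    refine SeveralComplex.not_isPeakPoint ht1 (hD.inter hV) hδ (fun p hp hr => ?_) hpeak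
    have hpUV := hball (mem_ball_zero_iff.mpr hp)
    have : p ∈ D ∩ U := by rw [hDU]; exact ⟨hpUV.1, hr⟩
    exact ⟨this.1, hpUV.2⟩
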